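/- Write $I=[0,1]$ and let $h:(0,1)\to\mathbb{R}$ be the homeomorphism $h(x)=\log x-\log\frac12$ for $x\in(0,\frac12]$, $h(x)=\log\frac12-\log(1-x)$ for $x\in[\frac12,1)$. Let $\mathrm{C}(\mathrm{I})$ be the set of continuous maps $f$ of $[0,1]$ onto itself with $f(0)=0$, $f(1)=1$, $f((0,1))\subset(0,1)$ and such that the one-sided derivatives $f'(0),f'(1)$ exist and lie in $(0,\infty)$, with the distance $d_{\mathrm{C}(\mathrm{I})}(f,g)=\sup_{x\in(0,1)}|h(f(x))-h(g(x))|$. Let $\mathrm{RDS}(\mathrm{I})$ be the set of triples $f=(f_0,f_1,p_f)\in \mathrm{C}(\mathrm{I})\times\mathrm{C}(\mathrm{I})\times(0,1)$ such that $f_0,f_1$ are homeomorphisms of $[0,1]$, $f_0(x)<x<f_1(x)$ for all $x\in(0,1)$, and $p_f\log f_0'(j)+(1-p_f)\log f_1'(j)>0$ for $j\in\{0,1\}$, with the metric $$d_m(f,g)=\max\{d_{\mathrm{C}(\mathrm{I})}(f_0,g_0),\,d_{\mathrm{C}(\mathrm{I})}(f_1,g_1),\,|p_f-p_g|\}.$$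 A Borel probability measure $\mu$ on $(0,1)$ is called stationary for $f$ if $\mu(A)=p_f\,\mu(f_0^{-1}(A))+(1-p_f)\,\mu(f_1^{-1}(A))$ for every Borel set $A\subset(0,1)$, and $\mu$ has full support if $\mu(U)>0$ for every non-empty open set $U\subset(0,1)$. **Theorem.** The set of systems $f\in\mathrm{RDS}(\mathrm{I})$ which have a unique stationary Borel probability measure $\mu_f$ on $(0,1)$ and for which $\mu_f$ has full support is dense in $(\mathrm{RDS}(\mathrm{I}),d_m)$. -/

import Mathlib

open Set MeasureTheory unitInterval

noncomputable section

/-- The homeomorphism `h : (0,1) → ℝ` used to measure distances in `(0,1)`. -/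
def hMap (x : Ioo (0 : ℝ) 1) : ℝ :=
  if (x : ℝ) ≤ 1 / 2 then Real.log x - Real.log (1 / 2) else Real.log (1 / 2) - Real.log (1 - x)

theorem hMap_injective : Function.Injective hMap := by
  have key : ∀ x y : Ioo (0 : ℝ) 1, (x : ℝ) < y → hMap x < hMap y := by
    rintro ⟨x, hx0, hx1⟩ ⟨y, hy0, hy1⟩ hxy
    simp only at hxy
    simp only [hMap]
    split_ifs with h1 h2 h2
    · have := Real.log_lt_log hx0 hxy
      linarith
    · have e1 := Real.log_le_log hx0 h1
      have e2 : Real.log (1 - y) < Real.log (1 / 2) :=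
        Real.log_lt_log (by linarith) (by linarith [not_le.mp h2])
      linarith
    · exact absurd (hxy.le.trans h2) h1
    · have : Real.log (1 - y) < Real.log (1 - x) :=
        Real.log_lt_log (by linarith) (by linarith)
      linarith
  intro x y hxy
  rcases lt_trichotomy (x : ℝ) y with h | h | h
  · exact absurd hxy (key x y h).ne
  · exact Subtype.ext h
  · exact absurd hxy (key y x h).ne'

/-- A self-map of `[0,1]` regarded as a real function (constant outside `[0,1]`); only its values
on `[0,1]` are ever used. -/
def realExt (f : I → I) : ℝ → ℝ := fun x => (f (projIcc 0 1 zero_le_one x) : ℝ)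

/-- The one-sided derivative at the endpoint `j` of `[0,1]`. -/
def endDeriv (f : I → I) (j : I) : ℝ := derivWithin (realExt f) (Icc 0 1) j

/-- The space `C(I)`: continuous maps of `[0,1]` fixing the endpoints (hence onto), mapping `(0,1)`
into `(0,1)`, with derivatives at both endpoints that exist and are strictly positive. -/
structure CI where
  toMap : C(I, I)
  map_zero : toMap 0 = 0
  map_one : toMap 1 = 1
  map_Ioo : ∀ x ∈ Ioo (0 : I) 1, toMap x ∈ Ioo (0 : I) 1
  diff_zero : DifferentiableWithinAt ℝ (realExt toMap) (Icc 0 1) 0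
  diff_one : DifferentiableWithinAt ℝ (realExt toMap) (Icc 0 1) 1
  deriv_zero_pos : 0 < endDeriv toMap 0
  deriv_one_pos : 0 < endDeriv toMap 1

/-- The restriction of `f ∈ C(I)` to a self-map of the open interval `(0,1)`. -/
def CI.onIoo (f : CI) (x : Ioo (0 : ℝ) 1) : Ioo (0 : ℝ) 1 :=
  ⟨(f.toMap ⟨x, x.2.1.le, x.2.2.le⟩ : ℝ), f.map_Ioo _ ⟨x.2.1, x.2.2⟩⟩

theorem CI.onIoo_injective : Function.Injective CI.onIoo := by
  intro f g h
  have hm : f.toMap = g.toMap := by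
    ext x
    rcases eq_or_ne x 0 with rfl | h0
    · rw [f.map_zero, g.map_zero]
    rcases eq_or_ne x 1 with rfl | h1
    · rw [f.map_one, g.map_one]
    have hx : (x : ℝ) ∈ Ioo (0 : ℝ) 1 := ⟨unitInterval.pos_iff_ne_zero.mpr h0,
      unitInterval.lt_one_iff_ne_one.mpr h1⟩
    exact congrArg (fun y : Ioo (0 : ℝ) 1 => (y : ℝ)) (congrFun h ⟨x, hx⟩)
  cases f
  cases g
  cases hm
  rfl

/-- The distance on `C(I)` is `sup_{x ∈ (0,1)} |h (f x) - h (g x)|`, the supremum being taken in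
`[0,∞]`. -/
instance : EMetricSpace CI where
  edist f g := ⨆ x : Ioo (0 : ℝ) 1, edist (hMap (f.onIoo x)) (hMap (g.onIoo x))
  edist_self f := by simp
  edist_comm f g := by simp only [edist_comm]
  edist_triangle f g k := iSup_le fun x =>
    (edist_triangle _ (hMap (g.onIoo x)) _).trans
      (add_le_add (le_iSup (fun x => edist (hMap (f.onIoo x)) (hMap (g.onIoo x))) x)
        (le_iSup (fun x => edist (hMap (g.onIoo x)) (hMap (k.onIoo x))) x))
  eq_of_edist_eq_zero {f g} h := by
    refine CI.onIoo_injective (funext fun x => hMap_injective ?_)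
    exact edist_eq_zero.mp (ENNReal.iSup_eq_zero.mp h x)

/-- The space `RDS(I)` of random dynamical systems `(f₀, f₁, p)`. -/
structure RDSI where
  f₀ : CI
  f₁ : CI
  p : ℝ
  homeo₀ : IsHomeomorph f₀.toMap
  homeo₁ : IsHomeomorph f₁.toMap
  below : ∀ x ∈ Ioo (0 : I) 1, f₀.toMap x < x
  above : ∀ x ∈ Ioo (0 : I) 1, x < f₁.toMap x
  p_mem : p ∈ Ioo (0 : ℝ) 1
  lyapunov_zero_pos :
    0 < p * Real.log (endDeriv f₀.toMap 0) + (1 - p) * Real.log (endDeriv f₁.toMap 0)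
  lyapunov_one_pos :
    0 < p * Real.log (endDeriv f₀.toMap 1) + (1 - p) * Real.log (endDeriv f₁.toMap 1)

/-- The underlying triple. -/
def RDSI.toTriple (f : RDSI) : CI × CI × ℝ := (f.f₀, f.f₁, f.p)

theorem RDSI.toTriple_injective : Function.Injective RDSI.toTriple := by
  rintro ⟨⟩ ⟨⟩ h
  simp only [RDSI.toTriple, Prod.mk.injEq] at h
  obtain ⟨rfl, rfl, rfl⟩ := h
  rfl

/-- The distance on `RDS(I)` is the maximum of the distances of the three components. -/
instance : EMetricSpace RDSI := EMetricSpace.induced RDSI.toTriple RDSI.toTriple_injective inferInstance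

/-- The Markov operator `P_f μ = p · (f₀)_* μ + (1 - p) · (f₁)_* μ` on Borel measures on `(0,1)`. -/
def RDSI.markov (f : RDSI) (μ : Measure (Ioo (0 : ℝ) 1)) : Measure (Ioo (0 : ℝ) 1) :=
  ENNReal.ofReal f.p • μ.map f.f₀.onIoo + ENNReal.ofReal (1 - f.p) • μ.map f.f₁.onIoo

/-- `μ` is a stationary probability measure on `(0,1)` for `f`. -/
def RDSI.IsStationary (f : RDSI) (μ : ProbabilityMeasure (Ioo (0 : ℝ) 1)) : Prop :=
  f.markov μ = μ

/-- `μ` has full support: every non-empty open subset of `(0,1)` has positive measure. -/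
def HasFullSupport (μ : ProbabilityMeasure (Ioo (0 : ℝ) 1)) : Prop :=
  ∀ U : Set (Ioo (0 : ℝ) 1), IsOpen U → U.Nonempty → 0 < (μ : Measure (Ioo (0 : ℝ) 1)) U

end

/-!
The homeomorphism `hMap` turns `(0,1)` into the line and a system `f` in `RDS(I)` into a pair of
increasing homeomorphisms `F₀`, `F₁` of `ℝ` with `F₀ t < t < F₁ t`. Near `±∞` these are close to
translations, by the logarithms of the end derivatives at `0` and by minus those at `1`, so that
the two conditions on the Lyapunov exponents say that the random walk on the line drifts inwards at
both ends.

*Every* system has exactly one stationary probability measure. A probability measure is stationary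
iff its distribution function `M` satisfies
`M t = p * M (F₀⁻¹ t) + (1 - p) * M (F₁⁻¹ t)` (`LineWalk.back`).
For existence, the drift near `-∞` makes `min 1 (exp (r * (t - T)))` a supersolution of this equation
when `r` is small (`LineWalk.exists_supersolution`); the reflected function gives a
subsolution below it, and the iterates of the subsolution increase to a monotone solution. For
uniqueness, the difference `D` of two distribution functions solves the same equation and vanishes
at `±∞`; where `D` is nearly maximal it remains so along the iterates of `F₀⁻¹`, which tend to `+∞`,
so `D ≤ 0` (`LineWalk.nonpos_of_back_eq`).

Full support can be enforced by a small perturbation. The support of the stationary measure is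
closed and preserved by `F₀` and `F₁`. If near `-∞` these are translations by `-α` and `β` with `β / α`
irrational, such a set contains a half-line near `-∞`, hence, by iterating `F₁`, everything
(`LineWalk.eq_univ_of_isClosed_of_mapsTo`). In the original coordinate this means that the maps are
linear near `0` with slopes `exp (-α)` and `exp β`. Any slope close to the derivative at `0` can be
achieved by a change of the map near `0` that is small for the distance of `C(I)` and does not
affect the derivative at `1` (`CI.exists_linear_near_zero`); slopes with irrational ratio of logarithms
can be chosen so close that the Lyapunov exponents remain positive.
-/

noncomputable section

open Filter Topology ProbabilityTheory

/-! ### Random walks on the line and uniqueness of the stationary measure -/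

theorem OrderIso.tendsto_iterate_atTop {F : ℝ ≃o ℝ} (hF : ∀ t, t < F t) (t : ℝ) :
    Tendsto (fun n : ℕ => F^[n] t) atTop atTop := by
  have hmono : Monotone fun n : ℕ => F^[n] t :=
    F.monotone.monotone_iterate_of_le_map (hF t).le
  rcases tendsto_atTop_of_monotone hmono with h | ⟨l, hl⟩
  · exact h
  · exact absurd (isFixedPt_of_tendsto_iterate hl F.continuous.continuousAt) (hF l).ne'

theorem OrderIso.tendsto_iterate_atBot {F : ℝ ≃o ℝ} (hF : ∀ t, F t < t) (t : ℝ) :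
    Tendsto (fun n : ℕ => F^[n] t) atTop atBot := by
  have hanti : Antitone fun n : ℕ => F^[n] t :=
    F.monotone.antitone_iterate_of_map_le (hF t).le
  rcases tendsto_atTop_of_antitone hanti with h | ⟨l, hl⟩
  · exact h
  · exact absurd (isFixedPt_of_tendsto_iterate hl F.continuous.continuousAt) (hF l).ne

/-- The conjugate of an increasing homeomorphism of the line by `t ↦ -t`. -/
def OrderIso.negConj (F : ℝ ≃o ℝ) : ℝ ≃o ℝ where
  toFun t := -F (-t)
  invFun t := -F.symm (-t)
  left_inv t := by simp
  right_inv t := by simp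
  map_rel_iff' := by simp

/-- Two increasing homeomorphisms of the line, applied with probabilities `p` and `1 - p`. -/
structure LineWalk where
  F₀ : ℝ ≃o ℝ
  F₁ : ℝ ≃o ℝ
  p : ℝ
  p_mem : p ∈ Ioo (0 : ℝ) 1

namespace LineWalk

variable (W : LineWalk)

/-- The operator induced on functions by the backward walk, which applies `F₀⁻¹` and `F₁⁻¹`.
Distribution functions of stationary measures are its fixed points. -/
def back (u : ℝ → ℝ) (t : ℝ) : ℝ := W.p * u (W.F₀.symm t) + (1 - W.p) * u (W.F₁.symm t)

theorem back_mono {u v : ℝ → ℝ} (h : ∀ t, u t ≤ v t) (t : ℝ) : W.back u t ≤ W.back v t := by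
  have := W.p_mem.1
  have := W.p_mem.2
  exact add_le_add (mul_le_mul_of_nonneg_left (h _) (by linarith))
    (mul_le_mul_of_nonneg_left (h _) (by linarith))

theorem back_monotone {u : ℝ → ℝ} (hu : Monotone u) : Monotone (W.back u) := by
  intro s t hst
  have := W.p_mem.1
  have := W.p_mem.2
  exact add_le_add
    (mul_le_mul_of_nonneg_left (hu (W.F₀.symm.monotone hst)) (by linarith))
    (mul_le_mul_of_nonneg_left (hu (W.F₁.symm.monotone hst)) (by linarith))

/-- The measure `μ` is invariant under the Markov operator of the walk. -/
def IsStationary (μ : Measure ℝ) : Prop :=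
  μ = ENNReal.ofReal W.p • μ.map W.F₀ + ENNReal.ofReal (1 - W.p) • μ.map W.F₁

theorem cdf_back_of_isStationary {μ : Measure ℝ} [IsProbabilityMeasure μ]
    (h : W.IsStationary μ) (t : ℝ) : cdf μ t = W.back (cdf μ) t := by
  have h0 : W.F₀ ⁻¹' Iic t = Iic (W.F₀.symm t) := W.F₀.preimage_Iic t
  have h1 : W.F₁ ⁻¹' Iic t = Iic (W.F₁.symm t) := W.F₁.preimage_Iic t
  have hp := W.p_mem
  have : μ.real (Iic t) = W.p * μ.real (Iic (W.F₀.symm t)) +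
      (1 - W.p) * μ.real (Iic (W.F₁.symm t)) := by
    conv_lhs => rw [h]
    rw [measureReal_def, Measure.add_apply, Measure.smul_apply, Measure.smul_apply,
      Measure.map_apply W.F₀.continuous.measurable measurableSet_Iic,
      Measure.map_apply W.F₁.continuous.measurable measurableSet_Iic, h0, h1,
      smul_eq_mul, smul_eq_mul, ENNReal.toReal_add (by finiteness) (by finiteness),
      ENNReal.toReal_mul, ENNReal.toReal_mul, ENNReal.toReal_ofReal hp.1.le,
      ENNReal.toReal_ofReal (by linarith [hp.2])]
    rfl
  simpa only [back, cdf_eq_real] using this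

theorem isStationary_of_cdf_back {μ : Measure ℝ} [IsProbabilityMeasure μ]
    (h : ∀ t, cdf μ t = W.back (cdf μ) t) : W.IsStationary μ := by
  have h0 (t) : W.F₀ ⁻¹' Iic t = Iic (W.F₀.symm t) := W.F₀.preimage_Iic t
  have h1 (t) : W.F₁ ⁻¹' Iic t = Iic (W.F₁.symm t) := W.F₁.preimage_Iic t
  have hp := W.p_mem
  refine Measure.ext_of_Iic _ _ fun t => ?_
  rw [Measure.add_apply, Measure.smul_apply, Measure.smul_apply,
      Measure.map_apply W.F₀.continuous.measurable measurableSet_Iic,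
      Measure.map_apply W.F₁.continuous.measurable measurableSet_Iic, h0, h1,
      smul_eq_mul, smul_eq_mul, ← ofReal_cdf, ← ofReal_cdf, ← ofReal_cdf,
      ← ENNReal.ofReal_mul hp.1.le, ← ENNReal.ofReal_mul (by linarith [hp.2]),
      ← ENNReal.ofReal_add (mul_nonneg hp.1.le (cdf_nonneg _ _))
        (mul_nonneg (by linarith [hp.2]) (cdf_nonneg _ _)), h t, back]

/-- Maximum principle for the backward walk. A value close to the supremum of `D` propagates, with
a controlled loss, along the iterates of `F₀⁻¹`, which escape to `+∞`, where `D` is small. -/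
theorem nonpos_of_back_eq (h₀ : ∀ t, W.F₀ t < t) {D : ℝ → ℝ} (hD : ∀ t, D t = W.back D t)
    (hbdd : BddAbove (range D)) (hbot : Tendsto D atBot (𝓝 0)) (htop : Tendsto D atTop (𝓝 0))
    (t : ℝ) : D t ≤ 0 := by
  have hp := W.p_mem.1
  have hp' := W.p_mem.2
  by_contra! ht
  set s := ⨆ t, D t
  have hs (t : ℝ) : D t ≤ s := le_ciSup hbdd t
  have hs0 : 0 < s := ht.trans_le (hs t)
  obtain ⟨a, ha⟩ := eventually_atBot.1 (hbot.eventually_lt_const (half_pos hs0))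
  obtain ⟨b, hb⟩ := eventually_atTop.1 (htop.eventually_lt_const (half_pos hs0))
  have hlt : ∀ t, t < W.F₀.symm t := fun t => by
    simpa using h₀ (W.F₀.symm t)
  obtain ⟨n, hn⟩ := ((OrderIso.tendsto_iterate_atTop hlt a).eventually_ge_atTop b).exists
  have key : ∀ (k : ℕ) (x η : ℝ), s - η < D x → s - η / W.p ^ k < D (W.F₀.symm^[k] x) := by
    intro k
    induction k with
    | zero => intro x η h; simpa using h
    | succ k ih =>
      intro x η h
      have h1 : s - η / W.p < D (W.F₀.symm x) := by
        have e := hD x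
        have e1 := mul_le_mul_of_nonneg_left (hs (W.F₁.symm x)) (by linarith : 0 ≤ 1 - W.p)
        rw [back] at e
        have e2 : W.p * s - η < W.p * D (W.F₀.symm x) := by linarith
        have e3 : W.p * (s - η / W.p) = W.p * s - η := by field_simp
        rw [← e3] at e2
        exact lt_of_mul_lt_mul_left e2 hp.le
      have := ih (W.F₀.symm x) (η / W.p) h1
      rwa [div_div, ← pow_succ'] at this
  have hη : s - W.p ^ n * (s / 2) < s := by
    have : 0 < W.p ^ n * (s / 2) := by positivity
    linarith
  obtain ⟨x, hx⟩ := exists_lt_of_lt_ciSup hη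
  have hax : a < x := by
    by_contra! hxa
    have := ha x hxa
    have h1 : W.p ^ n * (s / 2) ≤ 1 * (s / 2) :=
      mul_le_mul_of_nonneg_right (pow_le_one₀ hp.le hp'.le) (by linarith)
    linarith
  have h1 := key n x _ hx
  rw [mul_div_cancel_left₀ _ (by positivity)] at h1
  have h2 := hb _ (hn.trans (W.F₀.symm.monotone.iterate n hax.le))
  linarith

/-- The difference of two stationary distribution functions is fixed by `W.back` and vanishes at
`±∞`, so the maximum principle applies. -/
theorem isStationary_unique (h₀ : ∀ t, W.F₀ t < t) {μ ν : Measure ℝ} [IsProbabilityMeasure μ]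
    [IsProbabilityMeasure ν] (hμ : W.IsStationary μ) (hν : W.IsStationary ν) : μ = ν := by
  have key : ∀ (μ ν : Measure ℝ) [IsProbabilityMeasure μ] [IsProbabilityMeasure ν],
      W.IsStationary μ → W.IsStationary ν → ∀ t, cdf μ t ≤ cdf ν t := by
    intro μ ν _ _ hμ hν t
    refine sub_nonpos.1 (W.nonpos_of_back_eq h₀ (D := fun t => cdf μ t - cdf ν t)
      (fun t => ?_) ⟨1, ?_⟩ ?_ ?_ t)
    · simp only [W.cdf_back_of_isStationary hμ t, W.cdf_back_of_isStationary hν t, back]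
      ring
    · rintro _ ⟨t, rfl⟩
      have := cdf_le_one μ t
      have := cdf_nonneg ν t
      dsimp only
      linarith
    · simpa using (tendsto_cdf_atBot μ).sub (tendsto_cdf_atBot ν)
    · simpa using (tendsto_cdf_atTop μ).sub (tendsto_cdf_atTop ν)
  refine Measure.eq_of_cdf μ ν (StieltjesFunction.ext fun t => ?_)
  exact le_antisymm (key μ ν hμ hν t) (key ν μ hν hμ t)

end LineWalk

/-! ### Existence of a stationary measure -/

namespace LineWalk

variable (W : LineWalk)

/-- Between a monotone subsolution `u` and a supersolution `v` of `M = W.back M` there is a monotone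
solution, the increasing limit of the iterates of `W.back` at `u`. -/
theorem exists_monotone_back_eq {u v : ℝ → ℝ} (hu : Monotone u) (huv : ∀ t, u t ≤ v t)
    (hub : ∀ t, u t ≤ W.back u t) (hvb : ∀ t, W.back v t ≤ v t) :
    ∃ M : ℝ → ℝ, Monotone M ∧ (∀ t, u t ≤ M t) ∧ (∀ t, M t ≤ v t) ∧ ∀ t, M t = W.back M t := by
  let a : ℕ → ℝ → ℝ := fun n => W.back^[n] u
  have hsucc (n : ℕ) : a (n + 1) = W.back (a n) := Function.iterate_succ_apply' _ _ _
  have hmono (n : ℕ) : Monotone (a n) := by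
    induction n with
    | zero => exact hu
    | succ n ih => rw [hsucc]; exact W.back_monotone ih
  have hle (n : ℕ) (t : ℝ) : a n t ≤ v t := by
    induction n generalizing t with
    | zero => exact huv t
    | succ n ih => rw [hsucc]; exact (W.back_mono ih t).trans (hvb t)
  have hstep (n : ℕ) (t : ℝ) : a n t ≤ a (n + 1) t := by
    induction n generalizing t with
    | zero => exact hub t
    | succ n ih =>
      rw [hsucc, hsucc (n + 1)]
      exact W.back_mono ih t
  have hbdd (t : ℝ) : BddAbove (range fun n => a n t) :=
    ⟨v t, by rintro _ ⟨n, rfl⟩; exact hle n t⟩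
  have hlim (t : ℝ) : Tendsto (fun n => a n t) atTop (𝓝 (⨆ n, a n t)) :=
    tendsto_atTop_ciSup (monotone_nat_of_le_succ fun n => hstep n t) (hbdd t)
  refine ⟨fun t => ⨆ n, a n t, fun s t hst => ?_, fun t => le_ciSup (hbdd t) 0,
    fun t => ciSup_le fun n => hle n t, fun t => ?_⟩
  · exact ciSup_mono (hbdd t) fun n => hmono n hst
  · refine tendsto_nhds_unique ((tendsto_add_atTop_iff_nat 1).2 (hlim t)) ?_
    simp only [hsucc]
    exact ((hlim _).const_mul _).add ((hlim _).const_mul _)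

/-- The right-continuous version of a solution of `M = W.back M` is still a solution, hence the
distribution function of a stationary measure. -/
theorem exists_isStationary_of_back_eq {M : ℝ → ℝ} (hM : Monotone M)
    (hbot : Tendsto M atBot (𝓝 0)) (htop : Tendsto M atTop (𝓝 1)) (h : ∀ t, M t = W.back M t) :
    ∃ μ : Measure ℝ, IsProbabilityMeasure μ ∧ W.IsStationary μ := by
  let N := hM.stieltjesFunction
  have hN (t : ℝ) : N t = Function.rightLim M t := hM.stieltjesFunction_eq t
  have hNbot : Tendsto N atBot (𝓝 0) :=
    (tendsto_rightLim_atBot_of_tendsto hbot).congr fun t => (hN t).symm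
  have hNtop : Tendsto N atTop (𝓝 1) :=
    (tendsto_rightLim_atTop_of_tendsto htop).congr fun t => (hN t).symm
  have : IsProbabilityMeasure N.measure := N.isProbabilityMeasure hNbot hNtop
  refine ⟨N.measure, this, W.isStationary_of_cdf_back ?_⟩
  rw [cdf_measure_stieltjesFunction N hNbot hNtop]
  have hright (F : ℝ ≃o ℝ) (t : ℝ) : Tendsto (fun s => M (F s)) (𝓝[>] t) (𝓝 (N (F t))) := by
    rw [hN]
    refine (hM.tendsto_rightLim (F t)).comp (tendsto_nhdsWithin_of_tendsto_nhds_of_eventually_within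
      _ (F.continuous.continuousAt.mono_left nhdsWithin_le_nhds) ?_)
    filter_upwards [self_mem_nhdsWithin] with s hs
    exact F.strictMono hs
  intro t
  refine tendsto_nhds_unique (hright (OrderIso.refl ℝ) t) ?_
  simp only [OrderIso.refl_apply]
  rw [funext h]
  exact ((hright _ t).const_mul _).add ((hright _ t).const_mul _)

end LineWalk

/-- The left-hand side equals `1` at `r = 0` and has negative derivative there. -/
theorem exists_exp_moment_lt_one {p a b : ℝ} (h : 0 < p * a + (1 - p) * b) :
    ∃ r : ℝ, 0 < r ∧ p * Real.exp (-(r * a)) + (1 - p) * Real.exp (-(r * b)) < 1 := by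
  have hd (a : ℝ) : HasDerivAt (fun r => Real.exp (-(r * a))) (-a) 0 := by
    simpa using ((hasDerivAt_mul_const a).neg (x := (0 : ℝ))).exp
  have hd := ((hd a).const_mul p).add ((hd b).const_mul (1 - p))
  have hs := hd.tendsto_slope_zero_right
  have hneg : p * -a + (1 - p) * -b < 0 := by linarith
  obtain ⟨r, hr, hr0⟩ := ((hs.eventually_lt_const hneg).and self_mem_nhdsWithin).exists
  refine ⟨r, hr0, ?_⟩
  have hr0 : 0 < r := hr0
  simp only [Pi.add_apply, zero_add, zero_mul, neg_zero, Real.exp_zero, smul_eq_mul] at hr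
  have := (pos_iff_neg_of_mul_neg hr).1 (inv_pos.2 hr0)
  linarith

theorem OrderIso.tendsto_symm_sub {F : ℝ ≃o ℝ} {a : ℝ}
    (h : Tendsto (fun t => F t - t) atBot (𝓝 a)) :
    Tendsto (fun t => F.symm t - t) atBot (𝓝 (-a)) := by
  refine (h.comp F.symm.tendsto_atBot).neg.congr fun t => ?_
  simp

namespace LineWalk

variable (W : LineWalk)

/-- Inward drift near `-∞` makes `min 1 (exp (r * (t - T)))` a supersolution for small `r`. -/
theorem exists_supersolution {a₀ a₁ : ℝ} (h₀ : Tendsto (fun t => W.F₀ t - t) atBot (𝓝 a₀))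
    (h₁ : Tendsto (fun t => W.F₁ t - t) atBot (𝓝 a₁)) (hdrift : 0 < W.p * a₀ + (1 - W.p) * a₁) :
    ∃ v : ℝ → ℝ, Monotone v ∧ (∀ t, 0 ≤ v t) ∧ (∀ t, v t ≤ 1) ∧ (∀ t, 0 ≤ t → v t = 1) ∧
      Tendsto v atBot (𝓝 0) ∧ ∀ t, W.back v t ≤ v t := by
  obtain ⟨r, hr0, hr⟩ := exists_exp_moment_lt_one hdrift
  have hlim {F : ℝ ≃o ℝ} {a : ℝ} (h : Tendsto (fun t => F t - t) atBot (𝓝 a)) :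
      Tendsto (fun t => Real.exp (r * (F.symm t - t))) atBot (𝓝 (Real.exp (-(r * a)))) := by
    have := (OrderIso.tendsto_symm_sub h).const_mul r
    rw [mul_neg] at this
    exact (Real.continuous_exp.tendsto _).comp this
  have hev := (((hlim h₀).const_mul W.p).add ((hlim h₁).const_mul (1 - W.p))).eventually_lt_const hr
  obtain ⟨T, hT⟩ := eventually_atBot.1 hev
  -- The kink lies at `S ≤ 0`, so that the function is `1` on the right half-line.
  set S := min T 0
  have hmono : Monotone fun t => min 1 (Real.exp (r * (t - S))) := fun s t hst => by
    dsimp only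
    gcongr
  refine ⟨fun t => min 1 (Real.exp (r * (t - S))), hmono, fun t => by positivity,
    fun t => min_le_left _ _, fun t ht => ?_, ?_, fun t => ?_⟩
  · refine min_eq_left (Real.one_le_exp (mul_nonneg hr0.le ?_))
    linarith [min_le_right T 0]
  · have : Tendsto (fun t => Real.exp (r * (t - S))) atBot (𝓝 0) :=
      Real.tendsto_exp_atBot.comp
        ((tendsto_atBot_add_const_right _ (-S) tendsto_id).const_mul_atBot hr0)
    simpa using (tendsto_const_nhds (x := (1 : ℝ))).min this
  · have hp := W.p_mem
    refine le_min ?_ ?_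
    · refine (W.back_mono (v := fun _ => 1) (fun t => min_le_left _ _) t).trans ?_
      simp [back]
    · rcases le_total t S with ht | ht
      · refine (W.back_mono (v := fun t => Real.exp (r * (t - S)))
          (fun t => min_le_right _ _) t).trans ?_
        have hsplit (s : ℝ) : Real.exp (r * (s - S)) =
            Real.exp (r * (s - t)) * Real.exp (r * (t - S)) := by
          rw [← Real.exp_add]; ring_nf
        have := mul_le_mul_of_nonneg_right (hT t (ht.trans (min_le_left _ _))).le
          (Real.exp_pos (r * (t - S))).le
        rw [back, hsplit (W.F₀.symm t), hsplit (W.F₁.symm t)]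
        linarith
      · refine le_trans ?_ (Real.one_le_exp (mul_nonneg hr0.le (sub_nonneg.2 ht)))
        refine (W.back_mono (v := fun _ => 1) (fun t => min_le_left _ _) t).trans ?_
        simp [back]

/-- The walk seen through the reflection `t ↦ -t`. -/
def reflect : LineWalk where
  F₀ := W.F₀.negConj
  F₁ := W.F₁.negConj
  p := W.p
  p_mem := W.p_mem

theorem reflect_back (u : ℝ → ℝ) (t : ℝ) :
    W.reflect.back u (-t) = W.back (fun s => u (-s)) t := by
  simp [back, reflect, OrderIso.negConj, OrderIso.symm]

/-- Inward drift at both ends gives a stationary measure: the supersolution at `-∞` and one minus the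
reflected supersolution at `+∞` enclose a distribution function. -/
theorem exists_isStationary {a₀ a₁ b₀ b₁ : ℝ}
    (ha₀ : Tendsto (fun t => W.F₀ t - t) atBot (𝓝 a₀))
    (ha₁ : Tendsto (fun t => W.F₁ t - t) atBot (𝓝 a₁))
    (hb₀ : Tendsto (fun t => W.F₀ t - t) atTop (𝓝 b₀))
    (hb₁ : Tendsto (fun t => W.F₁ t - t) atTop (𝓝 b₁))
    (ha : 0 < W.p * a₀ + (1 - W.p) * a₁) (hb : W.p * b₀ + (1 - W.p) * b₁ < 0) :
    ∃ μ : Measure ℝ, IsProbabilityMeasure μ ∧ W.IsStationary μ := by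
  obtain ⟨v, -, hvn, hv1, hv0, hvbot, hv⟩ := W.exists_supersolution ha₀ ha₁ ha
  have hneg {F : ℝ ≃o ℝ} {b : ℝ} (h : Tendsto (fun t => F t - t) atTop (𝓝 b)) :
      Tendsto (fun t => F.negConj t - t) atBot (𝓝 (-b)) :=
    (h.comp tendsto_neg_atBot_atTop).neg.congr fun t => by
      simp only [Function.comp_apply, OrderIso.negConj, RelIso.coe_fn_mk, Equiv.coe_fn_mk]
      ring
  obtain ⟨w, hwm, hwn, -, hw0, hwbot, hw⟩ := W.reflect.exists_supersolution (hneg hb₀) (hneg hb₁)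
    (by simp only [reflect]; linarith)
  have hum : Monotone fun t => 1 - w (-t) := fun s t hst => by
    have := hwm (neg_le_neg hst)
    dsimp only
    linarith
  have huv (t : ℝ) : 1 - w (-t) ≤ v t := by
    rcases le_total t 0 with ht | ht
    · simpa [hw0 (-t) (by linarith)] using hvn t
    · have := hwn (-t)
      rw [hv0 t ht]
      linarith
  have hub (t : ℝ) : 1 - w (-t) ≤ W.back (fun t => 1 - w (-t)) t := by
    have := hw (-t)
    rw [reflect_back] at this
    simp only [back] at this ⊢
    linarith
  obtain ⟨M, hM, huM, hMv, hback⟩ := W.exists_monotone_back_eq hum huv hub hv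
  have hutop : Tendsto (fun t => 1 - w (-t)) atTop (𝓝 1) := by
    simpa using (hwbot.comp tendsto_neg_atTop_atBot).const_sub 1
  have hubot : Tendsto (fun t => 1 - w (-t)) atBot (𝓝 0) := by
    refine tendsto_const_nhds.congr' ?_
    filter_upwards [eventually_le_atBot 0] with t ht
    simp [hw0 (-t) (by linarith)]
  exact W.exists_isStationary_of_back_eq hM
    (tendsto_of_tendsto_of_tendsto_of_le_of_le hubot hvbot huM hMv)
    (tendsto_of_tendsto_of_tendsto_of_le_of_le hutop tendsto_const_nhds huM
      fun t => (hMv t).trans (hv1 t)) hback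

end LineWalk

/-! ### Minimality and full support -/

/-- For `z ≤ 0` the approximation of `z` by integer combinations of `β` and `α` can be achieved by
going up by `β` and down by `α`: the natural multiples of `β` are dense modulo `α`. -/
theorem exists_nat_mul_sub_nat_mul_near {α β z r : ℝ} (hα : 0 < α) (hβ : 0 < β)
    (hirr : Irrational (β / α)) (hz : z ≤ 0) (hr : 0 < r) :
    ∃ n m : ℕ, |n * β - m * α - z| < r := by
  have : Fact (0 < α) := ⟨hα⟩
  have hd : DenseRange (fun n : ℕ => n • (β : AddCircle α)) :=
    denseRange_zsmul_iff_nsmul.1 (AddCircle.denseRange_zsmul_coe_iff.2 hirr)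
  have hr' : 0 < min r α := lt_min hr hα
  have hopen : IsOpen ((QuotientAddGroup.mk : ℝ → AddCircle α) '' Metric.ball z (min r α)) :=
    QuotientAddGroup.isOpenMap_coe _ Metric.isOpen_ball
  obtain ⟨n, x, hx, hxn⟩ := hd.exists_mem_open hopen ⟨_, z, Metric.mem_ball_self hr', rfl⟩
  have h0 : ((n * β - x : ℝ) : AddCircle α) = 0 := by
    rw [AddCircle.coe_sub, ← nsmul_eq_mul, sub_eq_zero]
    exact hxn.symm
  obtain ⟨k, hk⟩ := AddCircle.coe_eq_zero_iff _ |>.1 h0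
  rw [zsmul_eq_mul] at hk
  rw [Metric.mem_ball, Real.dist_eq] at hx
  have hxα := (abs_lt.1 (hx.trans_le (min_le_right _ _))).2
  -- `z ≤ 0` and `|x - z| < α` exclude a negative multiple of `α`.
  have hk1 : -1 < k := by
    have h1 : 0 ≤ n * β := by positivity
    have h2 : (-1 : ℝ) * α < k * α := by linarith
    exact_mod_cast lt_of_mul_lt_mul_right h2 hα.le
  obtain ⟨m, rfl⟩ := Int.eq_ofNat_of_zero_le (by omega : 0 ≤ k)
  refine ⟨n, m, ?_⟩
  have : (n * β - m * α - z : ℝ) = x - z := by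
    push_cast at hk
    linarith
  rw [this]
  exact hx.trans_le (min_le_left _ _)

/-- The support of a measure that dominates a multiple of its image under `F` is preserved by
`F`. -/
theorem OrderIso.mapsTo_support (F : ℝ ≃o ℝ) {μ : Measure ℝ} {q : ENNReal} (hq : q ≠ 0)
    (h : q • μ.map F ≤ μ) : MapsTo F μ.support μ.support := by
  intro x hx
  rw [Measure.mem_support_iff_forall] at hx ⊢
  intro U hU
  obtain ⟨V, hVU, hV, hxV⟩ := mem_nhds_iff.1 hU
  have h1 : 0 < μ (F ⁻¹' V) := hx _ (F.continuous.continuousAt (hV.mem_nhds hxV))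
  have h2 := h V
  rw [Measure.smul_apply, Measure.map_apply F.continuous.measurable hV.measurableSet,
    smul_eq_mul] at h2
  exact (ENNReal.mul_pos hq h1.ne').trans_le (h2.trans (measure_mono hVU))

namespace LineWalk

variable (W : LineWalk)

/-- If both maps are translations near `-∞`, with incommensurable translation lengths, the walk
is minimal: a non-empty closed set preserved by both maps is the whole line. -/
theorem eq_univ_of_isClosed_of_mapsTo (h₀ : ∀ t, W.F₀ t < t) (h₁ : ∀ t, t < W.F₁ t)
    {α β c : ℝ} (hα : 0 < α) (hβ : 0 < β) (hirr : Irrational (β / α))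
    (hF₀ : ∀ t ≤ c, W.F₀ t = t - α) (hF₁ : ∀ t ≤ c, W.F₁ t = t + β)
    {S : Set ℝ} (hS : IsClosed S) (hne : S.Nonempty) (hS₀ : MapsTo W.F₀ S S)
    (hS₁ : MapsTo W.F₁ S S) : S = univ := by
  -- Some point `s ≤ c` lies in `S`; from there one first goes down and then up, so that all the
  -- points visited before the last one stay below `c`, where the maps are translations.
  obtain ⟨x, hx⟩ := hne
  obtain ⟨k, hk⟩ := ((OrderIso.tendsto_iterate_atBot h₀ x).eventually_le_atBot c).exists
  set s := W.F₀^[k] x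
  have hs : s ∈ S := hS₀.iterate k hx
  have hdown (m : ℕ) : s - m * α ∈ S := by
    induction m with
    | zero => simpa using hs
    | succ m ih =>
      have h1 : s - m * α ≤ c := by
        have : 0 ≤ m * α := by positivity
        linarith
      have := hS₀ ih
      rw [hF₀ _ h1] at this
      convert this using 1
      push_cast
      ring
  have hup (m n : ℕ) (h : s - m * α + n * β ≤ c + β) : s - m * α + n * β ∈ S := by
    induction n with
    | zero => simpa using hdown m
    | succ n ih =>
      push_cast at h
      have h1 : s - m * α + n * β ≤ c := by linarith
      have := hS₁ (ih (by linarith))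
      rw [hF₁ _ h1] at this
      convert this using 1
      push_cast
      ring
  have hIic : Iic s ⊆ S := by
    intro y hy
    rw [← hS.closure_eq, Metric.mem_closure_iff]
    intro r hr
    obtain ⟨n, m, hnm⟩ := exists_nat_mul_sub_nat_mul_near hα hβ hirr
      (sub_nonpos.2 (mem_Iic.1 hy)) (lt_min hr hβ)
    refine ⟨s - m * α + n * β, hup m n ?_, ?_⟩
    · have := (abs_lt.1 (hnm.trans_le (min_le_right _ _))).2
      have := mem_Iic.1 hy
      linarith
    · rw [dist_comm, Real.dist_eq]
      refine lt_of_eq_of_lt ?_ (hnm.trans_le (min_le_left _ _))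
      congr 1
      ring
  -- The iterates of `F₁` carry the half-line `Iic s` over every point.
  refine eq_univ_of_forall fun t => ?_
  have hlt : ∀ t, W.F₁.symm t < t := fun t => by
    simpa using h₁ (W.F₁.symm t)
  obtain ⟨n, hn⟩ := ((OrderIso.tendsto_iterate_atBot hlt t).eventually_le_atBot s).exists
  have := hS₁.iterate n (hIic hn)
  rwa [(show Function.LeftInverse W.F₁ W.F₁.symm from W.F₁.apply_symm_apply).iterate n t] at this

theorem support_eq_univ (h₀ : ∀ t, W.F₀ t < t) (h₁ : ∀ t, t < W.F₁ t)
    {α β c : ℝ} (hα : 0 < α) (hβ : 0 < β) (hirr : Irrational (β / α))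
    (hF₀ : ∀ t ≤ c, W.F₀ t = t - α) (hF₁ : ∀ t ≤ c, W.F₁ t = t + β)
    {μ : Measure ℝ} [IsProbabilityMeasure μ] (hμ : W.IsStationary μ) : μ.support = univ := by
  have hp := W.p_mem
  refine W.eq_univ_of_isClosed_of_mapsTo h₀ h₁ hα hβ hirr hF₀ hF₁ Measure.isClosed_support
    (Measure.nonempty_support (IsProbabilityMeasure.ne_zero μ)) ?_ ?_
  · refine OrderIso.mapsTo_support _ (ENNReal.ofReal_pos.2 hp.1).ne' ?_
    conv_rhs => rw [hμ]
    exact Measure.le_add_right le_rfl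
  · refine OrderIso.mapsTo_support _ (ENNReal.ofReal_pos.2 (sub_pos.2 hp.2)).ne' ?_
    conv_rhs => rw [hμ]
    exact Measure.le_add_left le_rfl

end LineWalk

/-! ### The line coordinate on `(0,1)` -/

theorem hMap_of_le {x : Ioo (0 : ℝ) 1} (h : (x : ℝ) ≤ 1 / 2) :
    hMap x = Real.log x - Real.log (1 / 2) := if_pos h

theorem hMap_of_ge {x : Ioo (0 : ℝ) 1} (h : 1 / 2 ≤ (x : ℝ)) :
    hMap x = Real.log (1 / 2) - Real.log (1 - x) := by
  rcases h.eq_or_lt with h | h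
  · rw [hMap_of_le h.ge, ← h]
    norm_num
  · exact if_neg h.not_ge

theorem hMap_strictMono : StrictMono hMap := by
  have hlow {x y : Ioo (0 : ℝ) 1} (hxy : x < y) (hy : (y : ℝ) ≤ 1 / 2) : hMap x < hMap y := by
    have hxy' : (x : ℝ) < y := hxy
    rw [hMap_of_le hy, hMap_of_le (hxy'.le.trans hy)]
    exact sub_lt_sub_right (Real.log_lt_log x.2.1 hxy') _
  have hhigh {x y : Ioo (0 : ℝ) 1} (hxy : x < y) (hx : 1 / 2 ≤ (x : ℝ)) : hMap x < hMap y := by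
    have hxy' : (x : ℝ) < y := hxy
    rw [hMap_of_ge hx, hMap_of_ge (hx.trans hxy'.le)]
    exact sub_lt_sub_left (Real.log_lt_log (by linarith [y.2.2]) (by linarith)) _
  let m : Ioo (0 : ℝ) 1 := ⟨1 / 2, by norm_num, by norm_num⟩
  intro x y hxy
  rcases le_or_gt y m with hy | hy
  · exact hlow hxy hy
  · rcases le_or_gt m x with hx | hx
    · exact hhigh hxy hx
    · exact (hlow hx le_rfl).trans (hhigh hy le_rfl)

theorem hMap_surjective : Function.Surjective hMap := by
  intro t
  rcases le_total t 0 with ht | ht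
  · have h1 := Real.exp_le_one_iff.2 ht
    have h0 := Real.exp_pos t
    refine ⟨⟨Real.exp t * (1 / 2), by positivity, by linarith⟩, ?_⟩
    rw [hMap_of_le (by simp only; linarith)]
    simp only
    rw [Real.log_mul h0.ne' (by norm_num), Real.log_exp]
    ring
  · have h1 := Real.exp_le_one_iff.2 (neg_nonpos.2 ht)
    have h0 := Real.exp_pos (-t)
    refine ⟨⟨1 - Real.exp (-t) * (1 / 2), by linarith, by linarith⟩, ?_⟩
    rw [hMap_of_ge (by simp only; linarith)]
    simp only
    rw [sub_sub_cancel, Real.log_mul h0.ne' (by norm_num), Real.log_exp]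
    ring

/-- `hMap` as an order isomorphism of `(0,1)` with the line. -/
def hIso : Ioo (0 : ℝ) 1 ≃o ℝ := hMap_strictMono.orderIsoOfSurjective hMap hMap_surjective

theorem hIso_apply (x : Ioo (0 : ℝ) 1) : hIso x = hMap x := rfl

namespace CI

variable (f : CI)

theorem coe_onIoo (x : Ioo (0 : ℝ) 1) : (f.onIoo x : ℝ) = realExt f.toMap x := by
  simp only [onIoo, realExt]
  rw [projIcc_of_mem zero_le_one ⟨x.2.1.le, x.2.2.le⟩]

theorem realExt_zero : realExt f.toMap 0 = 0 := by
  simp [realExt, f.map_zero]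

theorem realExt_one : realExt f.toMap 1 = 1 := by
  simp [realExt, f.map_one]

theorem hasDerivWithinAt_zero :
    HasDerivWithinAt (realExt f.toMap) (endDeriv f.toMap 0) (Icc 0 1) 0 :=
  f.diff_zero.hasDerivWithinAt

theorem hasDerivWithinAt_one :
    HasDerivWithinAt (realExt f.toMap) (endDeriv f.toMap 1) (Icc 0 1) 1 :=
  f.diff_one.hasDerivWithinAt

theorem tendsto_div_nhdsGT_zero :
    Tendsto (fun x => realExt f.toMap x / x) (𝓝[>] 0) (𝓝 (endDeriv f.toMap 0)) := by
  have h := hasDerivWithinAt_iff_tendsto_slope.1 f.hasDerivWithinAt_zero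
  refine (h.mono_left ?_).congr fun x => ?_
  · rw [Icc_sdiff_left, nhdsWithin_Ioc_eq_nhdsGT zero_lt_one]
  · simp [slope_def_field, f.realExt_zero]

theorem tendsto_div_nhdsLT_one :
    Tendsto (fun x => (1 - realExt f.toMap x) / (1 - x)) (𝓝[<] 1) (𝓝 (endDeriv f.toMap 1)) := by
  have h := hasDerivWithinAt_iff_tendsto_slope.1 f.hasDerivWithinAt_one
  refine (h.mono_left ?_).congr fun x => ?_
  · rw [Icc_sdiff_right, nhdsWithin_Ico_eq_nhdsLT zero_lt_one]
  · rw [slope_def_field, f.realExt_one, ← neg_sub 1 x, ← neg_sub 1 (realExt _ x), neg_div_neg_eq]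

theorem continuous_realExt : Continuous (realExt f.toMap) :=
  continuous_subtype_val.comp (f.toMap.continuous.comp continuous_projIcc)

theorem tendsto_hMap_sub_atBot :
    Tendsto (fun x => hMap (f.onIoo x) - hMap x) atBot (𝓝 (Real.log (endDeriv f.toMap 0))) := by
  have h1 : Tendsto (fun x => Real.log (realExt f.toMap x / x)) (𝓝[>] 0)
      (𝓝 (Real.log (endDeriv f.toMap 0))) :=
    (Real.continuousAt_log f.deriv_zero_pos.ne').tendsto.comp f.tendsto_div_nhdsGT_zero
  have h2 : ∀ᶠ x in 𝓝[>] (0 : ℝ), x ≤ 1 / 2 ∧ realExt f.toMap x ≤ 1 / 2 := by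
    refine nhdsWithin_le_nhds (((continuous_id.tendsto 0).eventually_le_const (by norm_num)).and
      ((f.continuous_realExt.tendsto 0).eventually_le_const ?_))
    rw [f.realExt_zero]
    norm_num
  rw [← comap_coe_Ioo_nhdsGT]
  refine (h1.comp tendsto_comap).congr' ?_
  filter_upwards [tendsto_comap.eventually h2] with x hx
  rw [hMap_of_le hx.1, hMap_of_le (by rw [coe_onIoo]; exact hx.2), Function.comp_apply,
    ← coe_onIoo, Real.log_div (f.onIoo x).2.1.ne' x.2.1.ne']
  ring

theorem tendsto_hMap_sub_atTop :
    Tendsto (fun x => hMap (f.onIoo x) - hMap x) atTop (𝓝 (-Real.log (endDeriv f.toMap 1))) := by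
  have h1 : Tendsto (fun x => -Real.log ((1 - realExt f.toMap x) / (1 - x))) (𝓝[<] 1)
      (𝓝 (-Real.log (endDeriv f.toMap 1))) :=
    ((Real.continuousAt_log f.deriv_one_pos.ne').tendsto.comp f.tendsto_div_nhdsLT_one).neg
  have h2 : ∀ᶠ x in 𝓝[<] (1 : ℝ), 1 / 2 ≤ x ∧ 1 / 2 ≤ realExt f.toMap x := by
    refine nhdsWithin_le_nhds (((continuous_id.tendsto 1).eventually_const_le (by norm_num)).and
      ((f.continuous_realExt.tendsto 1).eventually_const_le ?_))
    rw [f.realExt_one]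
    norm_num
  rw [← comap_coe_Ioo_nhdsLT]
  refine (h1.comp tendsto_comap).congr' ?_
  filter_upwards [tendsto_comap.eventually h2] with x hx
  rw [hMap_of_ge hx.1, hMap_of_ge (by rw [coe_onIoo]; exact hx.2), Function.comp_apply,
    ← coe_onIoo, Real.log_div (sub_pos.2 (f.onIoo x).2.2).ne' (sub_pos.2 x.2.2).ne']
  ring

variable {f}

theorem strictMono_toMap (hf : IsHomeomorph f.toMap) : StrictMono f.toMap :=
  f.toMap.continuous.strictMono_of_inj_boundedOrder
    (by rw [show (⊥ : I) = 0 from rfl, f.map_zero]; exact bot_le) hf.injective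

theorem strictMono_onIoo (hf : IsHomeomorph f.toMap) : StrictMono f.onIoo :=
  fun _ _ hxy => strictMono_toMap hf hxy

theorem surjective_onIoo (hf : IsHomeomorph f.toMap) : Function.Surjective f.onIoo := by
  intro y
  obtain ⟨x, hx⟩ := hf.surjective ⟨y, y.2.1.le, y.2.2.le⟩
  have h0 : x ≠ 0 := by
    rintro rfl
    rw [f.map_zero] at hx
    exact y.2.1.ne (congrArg Subtype.val hx)
  have h1 : x ≠ 1 := by
    rintro rfl
    rw [f.map_one] at hx
    exact y.2.2.ne' (congrArg Subtype.val hx)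
  exact ⟨⟨x, unitInterval.pos_iff_ne_zero.2 h0, unitInterval.lt_one_iff_ne_one.2 h1⟩,
    Subtype.ext (congrArg (fun z : I => (z : ℝ)) hx)⟩

/-- A homeomorphism in `C(I)` read on the line through `hMap`. -/
def lineMap (f : CI) (hf : IsHomeomorph f.toMap) : ℝ ≃o ℝ :=
  hIso.symm.trans (((strictMono_onIoo hf).orderIsoOfSurjective f.onIoo (surjective_onIoo hf)).trans
    hIso)

theorem lineMap_apply (hf : IsHomeomorph f.toMap) (t : ℝ) :
    f.lineMap hf t = hMap (f.onIoo (hIso.symm t)) := rfl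

theorem lineMap_hMap (hf : IsHomeomorph f.toMap) (x : Ioo (0 : ℝ) 1) :
    f.lineMap hf (hMap x) = hMap (f.onIoo x) := by
  rw [lineMap_apply, ← hIso_apply x, hIso.symm_apply_apply]

theorem tendsto_lineMap_sub_atBot (hf : IsHomeomorph f.toMap) :
    Tendsto (fun t => f.lineMap hf t - t) atBot (𝓝 (Real.log (endDeriv f.toMap 0))) := by
  refine (f.tendsto_hMap_sub_atBot.comp hIso.symm.tendsto_atBot).congr fun t => ?_
  simp [lineMap_apply, ← hIso_apply]

theorem tendsto_lineMap_sub_atTop (hf : IsHomeomorph f.toMap) :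
    Tendsto (fun t => f.lineMap hf t - t) atTop (𝓝 (-Real.log (endDeriv f.toMap 1))) := by
  refine (f.tendsto_hMap_sub_atTop.comp hIso.symm.tendsto_atTop).congr fun t => ?_
  simp [lineMap_apply, ← hIso_apply]

theorem map_map_hIso (hf : IsHomeomorph f.toMap) (μ : Measure (Ioo (0 : ℝ) 1)) :
    (μ.map f.onIoo).map hIso = (μ.map hIso).map (f.lineMap hf) := by
  have hc : Continuous f.onIoo :=
    ((strictMono_onIoo hf).orderIsoOfSurjective f.onIoo (surjective_onIoo hf)).continuous
  rw [Measure.map_map hIso.continuous.measurable hc.measurable,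
    Measure.map_map (f.lineMap hf).continuous.measurable hIso.continuous.measurable]
  congr 1
  ext x
  exact (lineMap_hMap hf x).symm

end CI

/-! ### Stationary measures of systems in `RDS(I)` -/

namespace RDSI

variable (f : RDSI)

/-- The random system read on the line through `hMap`. -/
def lineWalk : LineWalk where
  F₀ := f.f₀.lineMap f.homeo₀
  F₁ := f.f₁.lineMap f.homeo₁
  p := f.p
  p_mem := f.p_mem

theorem lineWalk_F₀_lt (t : ℝ) : f.lineWalk.F₀ t < t := by
  have := f.below ⟨hIso.symm t, (hIso.symm t).2.1.le, (hIso.symm t).2.2.le⟩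
    ⟨(hIso.symm t).2.1, (hIso.symm t).2.2⟩
  calc f.lineWalk.F₀ t < hIso (hIso.symm t) := hIso.strictMono this
    _ = t := hIso.apply_symm_apply t

theorem lt_lineWalk_F₁ (t : ℝ) : t < f.lineWalk.F₁ t := by
  have := f.above ⟨hIso.symm t, (hIso.symm t).2.1.le, (hIso.symm t).2.2.le⟩
    ⟨(hIso.symm t).2.1, (hIso.symm t).2.2⟩
  calc t = hIso (hIso.symm t) := (hIso.apply_symm_apply t).symm
    _ < f.lineWalk.F₁ t := hIso.strictMono this

theorem isStationary_lineWalk_iff (μ : ProbabilityMeasure (Ioo (0 : ℝ) 1)) :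
    f.lineWalk.IsStationary ((μ : Measure (Ioo (0 : ℝ) 1)).map hIso) ↔ f.IsStationary μ := by
  have h : (f.markov μ).map hIso = ENNReal.ofReal f.p •
      ((μ : Measure (Ioo (0 : ℝ) 1)).map hIso).map f.lineWalk.F₀ +
      ENNReal.ofReal (1 - f.p) •
      ((μ : Measure (Ioo (0 : ℝ) 1)).map hIso).map f.lineWalk.F₁ := by
    rw [markov, Measure.map_add _ _ hIso.continuous.measurable, Measure.map_smul,
      Measure.map_smul, CI.map_map_hIso f.homeo₀, CI.map_map_hIso f.homeo₁]
    rfl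
  have hinj : Function.Injective fun ν : Measure (Ioo (0 : ℝ) 1) => ν.map hIso :=
    hIso.toHomeomorph.toMeasurableEquiv.map_measurableEquiv_injective
  rw [LineWalk.IsStationary, IsStationary, ← hinj.eq_iff, eq_comm]
  exact Iff.of_eq (congrArg (· = _) h.symm)

/-- Every system in `RDS(I)` has exactly one stationary probability measure. -/
theorem existsUnique_isStationary :
    ∃ μ : ProbabilityMeasure (Ioo (0 : ℝ) 1), f.IsStationary μ ∧
      ∀ ν : ProbabilityMeasure (Ioo (0 : ℝ) 1), f.IsStationary ν → ν = μ := by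
  obtain ⟨ν, hν, hst⟩ := f.lineWalk.exists_isStationary
    (CI.tendsto_lineMap_sub_atBot f.homeo₀) (CI.tendsto_lineMap_sub_atBot f.homeo₁)
    (CI.tendsto_lineMap_sub_atTop f.homeo₀) (CI.tendsto_lineMap_sub_atTop f.homeo₁)
    f.lyapunov_zero_pos (by
      have := f.lyapunov_one_pos
      simp only [lineWalk]
      linarith)
  have hs : Measurable hIso.symm := hIso.symm.continuous.measurable
  have hm : Measurable hIso := hIso.continuous.measurable
  let μ : ProbabilityMeasure (Ioo (0 : ℝ) 1) :=
    ⟨ν.map hIso.symm, Measure.isProbabilityMeasure_map hs.aemeasurable⟩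
  have hμ : (μ : Measure (Ioo (0 : ℝ) 1)).map hIso = ν :=
    hIso.toHomeomorph.toMeasurableEquiv.map_map_symm
  refine ⟨μ, ?_, fun ρ hρ => ?_⟩
  · rw [← isStationary_lineWalk_iff, hμ]
    exact hst
  · have := Measure.isProbabilityMeasure_map (μ := (ρ : Measure (Ioo (0 : ℝ) 1))) hm.aemeasurable
    have h := f.lineWalk.isStationary_unique f.lineWalk_F₀_lt
      ((f.isStationary_lineWalk_iff ρ).2 hρ) hst
    exact Subtype.ext (hIso.toHomeomorph.toMeasurableEquiv.map_measurableEquiv_injective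
      (h.trans hμ.symm))

/-- A stationary measure has full support as soon as both maps are linear near `0`, with
incommensurable logarithms of slopes. -/
theorem hasFullSupport_of_isStationary {κ₀ κ₁ c : ℝ} (hc : 0 < c) (hκ₀ : 0 < κ₀) (hκ₀' : κ₀ < 1)
    (hκ₁ : 1 < κ₁) (hirr : Irrational (Real.log κ₁ / -Real.log κ₀))
    (h₀ : ∀ x ≤ c, 0 ≤ x → realExt f.f₀.toMap x = κ₀ * x)
    (h₁ : ∀ x ≤ c, 0 ≤ x → realExt f.f₁.toMap x = κ₁ * x)
    {μ : ProbabilityMeasure (Ioo (0 : ℝ) 1)} (hμ : f.IsStationary μ) : HasFullSupport μ := by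
  have hm : Measurable hIso := hIso.continuous.measurable
  have := Measure.isProbabilityMeasure_map (μ := (μ : Measure (Ioo (0 : ℝ) 1))) hm.aemeasurable
  have hlin {g : CI} (hg : IsHomeomorph g.toMap) {κ : ℝ} (hκ : 0 < κ)
      (h : ∀ x ≤ c, 0 ≤ x → realExt g.toMap x = κ * x) :
      ∀ᶠ t in atBot, g.lineMap hg t = t + Real.log κ := by
    have h2 : ∀ᶠ x in 𝓝[>] (0 : ℝ), x ≤ c ∧ x ≤ 1 / 2 ∧ κ * x ≤ 1 / 2 := by
      refine nhdsWithin_le_nhds (((continuous_id.tendsto 0).eventually_le_const hc).and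
        (((continuous_id.tendsto 0).eventually_le_const (by norm_num)).and
        (((continuous_const_mul κ).tendsto 0).eventually_le_const (by norm_num))))
    have h3 : ∀ᶠ x : Ioo (0 : ℝ) 1 in atBot, (x : ℝ) ≤ c ∧ (x : ℝ) ≤ 1 / 2 ∧ κ * x ≤ 1 / 2 := by
      rw [← comap_coe_Ioo_nhdsGT]
      exact tendsto_comap.eventually h2
    filter_upwards [hIso.symm.tendsto_atBot.eventually h3] with t ht
    have hx := (hIso.symm t).2.1
    have he : (g.onIoo (hIso.symm t) : ℝ) = κ * (hIso.symm t : ℝ) := by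
      rw [CI.coe_onIoo, h _ ht.1 hx.le]
    have ht' : t = hMap (hIso.symm t) := (hIso.apply_symm_apply t).symm
    rw [CI.lineMap_apply, hMap_of_le (he.trans_le ht.2.2), he, Real.log_mul hκ.ne' hx.ne']
    conv_rhs => rw [ht', hMap_of_le ht.2.1]
    ring
  obtain ⟨T, hT⟩ := eventually_atBot.1
    ((hlin f.homeo₀ hκ₀ h₀).and (hlin f.homeo₁ (zero_lt_one.trans hκ₁) h₁))
  have hsupp := f.lineWalk.support_eq_univ f.lineWalk_F₀_lt f.lt_lineWalk_F₁
    (neg_pos.2 (Real.log_neg hκ₀ hκ₀')) (Real.log_pos hκ₁) hirr (c := T)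
    (fun t ht => by rw [sub_neg_eq_add]; exact (hT t ht).1) (fun t ht => (hT t ht).2)
    ((f.isStationary_lineWalk_iff μ).2 hμ)
  intro U hU hne
  obtain ⟨x, hx⟩ := hne
  have hV : IsOpen (hIso.symm ⁻¹' U) := hU.preimage hIso.symm.continuous
  have hmem : hIso x ∈ ((μ : Measure (Ioo (0 : ℝ) 1)).map hIso).support := hsupp ▸ mem_univ _
  have := (Measure.mem_support_iff_forall _).1 hmem _
    (hV.mem_nhds (by simpa using hx))
  rw [Measure.map_apply hm hV.measurableSet, ← preimage_comp] at this
  simpa [Function.comp_def] using this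

end RDSI

/-! ### Linearization near `0` -/

theorem realExt_coe (k : I → I) (x : I) : realExt k x = k x := by
  simp [realExt]

theorem realExt_of_mem (k : I → I) {x : ℝ} (hx : x ∈ Icc (0 : ℝ) 1) : realExt k x = k ⟨x, hx⟩ :=
  realExt_coe k ⟨x, hx⟩

namespace CI

variable {f : CI}

theorem strictMonoOn_realExt (hf : IsHomeomorph f.toMap) :
    StrictMonoOn (realExt f.toMap) (Icc 0 1) := by
  intro x hx y hy hxy
  rw [realExt_of_mem _ hx, realExt_of_mem _ hy]
  exact strictMono_toMap hf hxy

/-- The self-map of `[0,1]` given by an increasing function on the line fixing `0` and `1`. -/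
def mapOfStrictMonoOn (G : ℝ → ℝ) (hG : Continuous G) (hmono : StrictMonoOn G (Icc 0 1))
    (h0 : G 0 = 0) (h1 : G 1 = 1) : C(I, I) where
  toFun x := ⟨G x, by
    have a := hmono.monotoneOn (left_mem_Icc.2 zero_le_one) x.2 x.2.1
    rwa [h0] at a, by
    have a := hmono.monotoneOn x.2 (right_mem_Icc.2 zero_le_one) x.2.2
    rwa [h1] at a⟩
  continuous_toFun := by fun_prop

theorem isHomeomorph_mapOfStrictMonoOn {G : ℝ → ℝ} (hG : Continuous G)
    (hmono : StrictMonoOn G (Icc 0 1)) (h0 : G 0 = 0) (h1 : G 1 = 1) :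
    IsHomeomorph (mapOfStrictMonoOn G hG hmono h0 h1) := by
  refine isHomeomorph_iff_continuous_bijective.2 ⟨ContinuousMap.continuous _, fun x y h => ?_,
    fun y => ?_⟩
  · exact Subtype.ext (hmono.injOn x.2 y.2 (congrArg Subtype.val h))
  · have hy : (y : ℝ) ∈ Icc (G 0) (G 1) := by rw [h0, h1]; exact y.2
    obtain ⟨x, hx, hxy⟩ := intermediate_value_Icc zero_le_one hG.continuousOn hy
    exact ⟨⟨x, hx⟩, Subtype.ext hxy⟩

theorem realExt_mapOfStrictMonoOn {G : ℝ → ℝ} (hG : Continuous G)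
    (hmono : StrictMonoOn G (Icc 0 1)) (h0 : G 0 = 0) (h1 : G 1 = 1) {x : ℝ} (hx : x ∈ Icc 0 1) :
    realExt (mapOfStrictMonoOn G hG hmono h0 h1) x = G x :=
  realExt_of_mem _ hx

/-- An increasing function on the line which fixes `0` and `1`, with positive derivatives there,
restricts to a homeomorphism in `C(I)`. -/
theorem exists_of_strictMonoOn {G : ℝ → ℝ} (hG : Continuous G)
    (hmono : StrictMonoOn G (Icc 0 1)) (h0 : G 0 = 0) (h1 : G 1 = 1) {d₀ d₁ : ℝ}
    (hd₀ : HasDerivWithinAt G d₀ (Icc 0 1) 0) (hd₁ : HasDerivWithinAt G d₁ (Icc 0 1) 1)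
    (hd₀' : 0 < d₀) (hd₁' : 0 < d₁) :
    ∃ g : CI, IsHomeomorph g.toMap ∧ (∀ x ∈ Icc (0 : ℝ) 1, realExt g.toMap x = G x) ∧
      endDeriv g.toMap 0 = d₀ ∧ endDeriv g.toMap 1 = d₁ := by
  set k := mapOfStrictMonoOn G hG hmono h0 h1
  have hk : ∀ x ∈ Icc (0 : ℝ) 1, realExt k x = G x := fun x hx =>
    realExt_mapOfStrictMonoOn hG hmono h0 h1 hx
  have hk₀ : HasDerivWithinAt (realExt k) d₀ (Icc 0 1) 0 :=
    hd₀.congr hk (hk _ (left_mem_Icc.2 zero_le_one))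
  have hk₁ : HasDerivWithinAt (realExt k) d₁ (Icc 0 1) 1 :=
    hd₁.congr hk (hk _ (right_mem_Icc.2 zero_le_one))
  have he₀ : endDeriv k 0 = d₀ :=
    hk₀.derivWithin (uniqueDiffOn_Icc zero_lt_one _ (left_mem_Icc.2 zero_le_one))
  have he₁ : endDeriv k 1 = d₁ :=
    hk₁.derivWithin (uniqueDiffOn_Icc zero_lt_one _ (right_mem_Icc.2 zero_le_one))
  have hk0 : k 0 = 0 := Subtype.ext h0
  have hk1 : k 1 = 1 := Subtype.ext h1
  have hkm : StrictMono k := fun x y hxy => hmono x.2 y.2 hxy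
  exact ⟨⟨k, hk0, hk1, fun x hx => ⟨hk0 ▸ hkm hx.1, hk1 ▸ hkm hx.2⟩, hk₀.differentiableWithinAt,
    hk₁.differentiableWithinAt, he₀ ▸ hd₀', he₁ ▸ hd₁'⟩,
    isHomeomorph_mapOfStrictMonoOn hG hmono h0 h1, hk, he₀, he₁⟩

/-- A homeomorphism in `C(I)` can be replaced near `0` by a linear map of any slope close to its
derivative: an affine piece on `[a, b]` joins the graph of `x ↦ κ * x` to that of `f`. The graph of
the new map over `[0, b]` lies in the same thin cone as that of `f`, whence the distance bound. -/
theorem exists_linear_near_zero (hf : IsHomeomorph f.toMap) {κ δ : ℝ} (hκ : 0 < κ)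
    (hδ : |Real.log (endDeriv f.toMap 0) - Real.log κ| < δ) :
    ∃ g : CI, IsHomeomorph g.toMap ∧ edist f g ≤ ENNReal.ofReal (2 * δ) ∧
      endDeriv g.toMap 0 = κ ∧ endDeriv g.toMap 1 = endDeriv f.toMap 1 ∧
      (∃ a : ℝ, 0 < a ∧ ∀ x ≤ a, 0 ≤ x → realExt g.toMap x = κ * x) ∧
      (κ < 1 → (∀ x ∈ Ioo (0 : I) 1, f.toMap x < x) → ∀ x ∈ Ioo (0 : I) 1, g.toMap x < x) ∧
      (1 < κ → (∀ x ∈ Ioo (0 : I) 1, x < f.toMap x) → ∀ x ∈ Ioo (0 : I) 1, x < g.toMap x) := by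
  set φ := realExt f.toMap with hφ
  have hδ0 : 0 < δ := (abs_nonneg _).trans_lt hδ
  have hlog : Tendsto (fun x => Real.log (φ x / x)) (𝓝[>] 0)
      (𝓝 (Real.log (endDeriv f.toMap 0))) :=
    (Real.continuousAt_log f.deriv_zero_pos.ne').tendsto.comp f.tendsto_div_nhdsGT_zero
  have hφm : StrictMonoOn φ (Icc 0 1) := strictMonoOn_realExt hf
  have hφ0 : φ 0 = 0 := f.realExt_zero
  have hφ1 : φ 1 = 1 := f.realExt_one
  have hφpos {x : ℝ} (hx : 0 < x) (hx1 : x ≤ 1) : 0 < φ x :=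
    hφ0 ▸ hφm (left_mem_Icc.2 zero_le_one) ⟨hx.le, hx1⟩ hx
  -- An interval on which the graph of `f` lies in the cone of slopes `κ * exp (± δ)`.
  obtain ⟨b, hb0, hb⟩ : ∃ b : ℝ, 0 < b ∧ ∀ x, 0 < x → x ≤ b →
      |Real.log (φ x / x) - Real.log κ| < δ ∧ x ≤ 1 / 2 ∧ φ x ≤ 1 / 2 := by
    have h1 : ∀ᶠ x in 𝓝[>] (0 : ℝ), |Real.log (φ x / x) - Real.log κ| < δ :=
      ((hlog.sub_const _).abs).eventually_lt_const hδ
    have h2 : ∀ᶠ x in 𝓝[>] (0 : ℝ), x ≤ 1 / 2 ∧ φ x ≤ 1 / 2 := by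
      refine nhdsWithin_le_nhds (((continuous_id.tendsto 0).eventually_le_const (by norm_num)).and
        ((f.continuous_realExt.tendsto 0).eventually_le_const ?_))
      rw [f.realExt_zero]
      norm_num
    obtain ⟨b, hb0, hb⟩ := mem_nhdsGT_iff_exists_Ioc_subset.1 (h1.and h2)
    exact ⟨b, hb0, fun x hx hxb => hb ⟨hx, hxb⟩⟩
  have hb2 : b ≤ 1 / 2 := (hb b hb0 le_rfl).2.1
  have hφb : 0 < φ b := hφpos hb0 (by linarith)
  have hcone {x : ℝ} (hx : 0 < x) (hxb : x ≤ b) :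
      κ * Real.exp (-δ) * x < φ x ∧ φ x < κ * Real.exp δ * x := by
    have h := abs_lt.1 (hb x hx hxb).1
    have hφx : 0 < φ x / x := div_pos (hφpos hx (by linarith)) hx
    have e : Real.log (κ * Real.exp (-δ)) < Real.log (φ x / x) := by
      rw [Real.log_mul hκ.ne' (Real.exp_pos _).ne', Real.log_exp]
      linarith
    have e' : Real.log (φ x / x) < Real.log (κ * Real.exp δ) := by
      rw [Real.log_mul hκ.ne' (Real.exp_pos _).ne', Real.log_exp]
      linarith
    rw [Real.log_lt_log_iff (by positivity) hφx, lt_div_iff₀ hx] at e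
    rw [Real.log_lt_log_iff hφx (by positivity), div_lt_iff₀ hx] at e'
    exact ⟨e, e'⟩
  -- The cone condition at `b` gives `κ * a < φ b`: the affine piece is increasing.
  set a := Real.exp (-δ) * b with ha
  have ha0 : 0 < a := by positivity
  have hab : a < b := mul_lt_of_lt_one_left hb0 (Real.exp_lt_one_iff.2 (by linarith))
  have hκa : κ * a < φ b := by
    rw [ha, ← mul_assoc]
    exact (hcone hb0 le_rfl).1
  set m := (φ b - κ * a) / (b - a) with hm
  have hm0 : 0 < m := div_pos (by linarith) (by linarith)
  have hmb : m * (b - a) = φ b - κ * a := div_mul_cancel₀ _ (by linarith)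
  let G : ℝ → ℝ := fun x => κ * min x a + m * (max a (min x b) - a) + (φ (max x b) - φ b)
  have hGlow {x : ℝ} (hx : x ≤ a) : G x = κ * x := by
    simp only [G]
    rw [min_eq_left hx, min_eq_left (hx.trans hab.le), max_eq_left hx,
      max_eq_right (hx.trans hab.le)]
    ring
  have hGmid {x : ℝ} (hax : a ≤ x) (hxb : x ≤ b) : G x = κ * a + m * (x - a) := by
    simp only [G]
    rw [min_eq_right hax, min_eq_left hxb, max_eq_right hax, max_eq_right hxb]
    ring
  have hGhigh {x : ℝ} (hx : b ≤ x) : G x = φ x := by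
    simp only [G]
    rw [min_eq_right (hab.le.trans hx), min_eq_right hx, max_eq_right hab.le, max_eq_left hx, hmb]
    ring
  have hGc : Continuous G := by
    have := f.continuous_realExt
    fun_prop
  have hGm : StrictMonoOn G (Icc 0 1) := by
    have h1 : StrictMonoOn G (Icc 0 a) := fun x hx y hy hxy => by
      rw [hGlow hx.2, hGlow hy.2]
      exact mul_lt_mul_of_pos_left hxy hκ
    have h2 : StrictMonoOn G (Icc a b) := fun x hx y hy hxy => by
      rw [hGmid hx.1 hx.2, hGmid hy.1 hy.2]
      have := mul_lt_mul_of_pos_left hxy hm0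
      linarith
    have h3 : StrictMonoOn G (Icc b 1) := fun x hx y hy hxy => by
      rw [hGhigh hx.1, hGhigh hy.1]
      exact hφm ⟨hb0.le.trans hx.1, hx.2⟩ ⟨hb0.le.trans hy.1, hy.2⟩ hxy
    have h12 := h1.union h2 (isGreatest_Icc ha0.le) (isLeast_Icc hab.le)
    rw [Icc_union_Icc_eq_Icc ha0.le hab.le] at h12
    have h123 := h12.union h3 (isGreatest_Icc hb0.le) (isLeast_Icc (by linarith))
    rwa [Icc_union_Icc_eq_Icc hb0.le (by linarith)] at h123
  -- Over `[a, b]` the graph of `G` is the segment joining `(a, κ * a)` to `(b, φ b)`.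
  have hseg {x : ℝ} (hax : a ≤ x) (hxb : x ≤ b) :
      (b - a) * G x = κ * a * (b - x) + φ b * (x - a) := by
    rw [hGmid hax hxb]
    linear_combination (x - a) * hmb
  have hGcone {x : ℝ} (hx : 0 < x) (hxb : x ≤ b) :
      κ * Real.exp (-δ) * x ≤ G x ∧ G x ≤ κ * Real.exp δ * x := by
    have e1 : κ * Real.exp (-δ) ≤ κ :=
      mul_le_of_le_one_right hκ.le (Real.exp_le_one_iff.2 (by linarith))
    have e2 : κ ≤ κ * Real.exp δ := le_mul_of_one_le_right hκ.le (Real.one_le_exp hδ0.le)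
    rcases le_total x a with hxa | hax
    · rw [hGlow hxa]
      exact ⟨mul_le_mul_of_nonneg_right e1 hx.le, mul_le_mul_of_nonneg_right e2 hx.le⟩
    · have h := hseg hax hxb
      have hc := hcone hb0 le_rfl
      have l1 := mul_le_mul_of_nonneg_right e1 (mul_nonneg ha0.le (sub_nonneg.2 hxb))
      have l2 := mul_le_mul_of_nonneg_right hc.1.le (sub_nonneg.2 hax)
      have u1 := mul_le_mul_of_nonneg_right e2 (mul_nonneg ha0.le (sub_nonneg.2 hxb))
      have u2 := mul_le_mul_of_nonneg_right hc.2.le (sub_nonneg.2 hax)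
      constructor <;> refine le_of_mul_le_mul_left ?_ (sub_pos.2 hab) <;> rw [h] <;> linarith
  have hd₀ : HasDerivWithinAt G κ (Icc 0 1) 0 := by
    refine ((hasDerivAt_mul_const κ).hasDerivWithinAt).congr_of_eventuallyEq ?_ ?_
    · filter_upwards [nhdsWithin_le_nhds (Iic_mem_nhds ha0)] with x hx
      rw [hGlow hx, mul_comm]
    · rw [hGlow ha0.le, mul_comm]
  have hd₁ : HasDerivWithinAt G (endDeriv f.toMap 1) (Icc 0 1) 1 := by
    refine f.hasDerivWithinAt_one.congr_of_eventuallyEq ?_ (hGhigh (by linarith))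
    filter_upwards [nhdsWithin_le_nhds (Ici_mem_nhds (show b < 1 by linarith))] with x hx
    exact hGhigh hx
  obtain ⟨g, hg, hgG, hg0, hg1⟩ := exists_of_strictMonoOn hGc hGm
    (by rw [hGlow ha0.le, mul_zero]) (by rw [hGhigh (by linarith), hφ1]) hd₀ hd₁ hκ f.deriv_one_pos
  refine ⟨g, hg, iSup_le fun x => ?_, hg0, hg1,
    ⟨a, ha0, fun x hxa hx => ?_⟩, fun hκ1 hlt x hx => ?_, fun hκ1 hlt x hx => ?_⟩
  · have hfx : (f.onIoo x : ℝ) = φ x := f.coe_onIoo x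
    have hgx : (g.onIoo x : ℝ) = G x := by
      rw [g.coe_onIoo, hgG _ ⟨x.2.1.le, x.2.2.le⟩]
    rcases le_total b x with hbx | hxb
    · have : f.onIoo x = g.onIoo x := Subtype.ext (by rw [hfx, hgx, hGhigh hbx])
      simp [this]
    · have hf2 : (f.onIoo x : ℝ) ≤ 1 / 2 := hfx.trans_le (hb x x.2.1 hxb).2.2
      have hg2 : (g.onIoo x : ℝ) ≤ 1 / 2 := by
        refine hgx.trans_le ((hGm.monotoneOn ⟨x.2.1.le, x.2.2.le⟩ ⟨hb0.le, by linarith⟩ hxb).trans ?_)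
        rw [hGhigh le_rfl]
        exact (hb b hb0 le_rfl).2.2
      have hl {y : ℝ} (hy : κ * Real.exp (-δ) * x ≤ y ∧ y ≤ κ * Real.exp δ * x) :
          Real.log κ + Real.log x - δ ≤ Real.log y ∧ Real.log y ≤ Real.log κ + Real.log x + δ := by
        have hx0 := x.2.1
        have hexp (s : ℝ) : Real.log (κ * Real.exp s * x) = Real.log κ + Real.log x + s := by
          rw [Real.log_mul (by positivity) hx0.ne', Real.log_mul hκ.ne' (by positivity),
            Real.log_exp]
          ring
        have h1 : 0 < κ * Real.exp (-δ) * x := by positivity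
        have := Real.log_le_log h1 hy.1
        have := Real.log_le_log (h1.trans_le hy.1) hy.2
        rw [hexp] at *
        constructor <;> linarith
      have h1 := hl (y := φ x) ⟨(hcone x.2.1 hxb).1.le, (hcone x.2.1 hxb).2.le⟩
      have h2 := hl (hGcone x.2.1 hxb)
      rw [edist_dist, Real.dist_eq, hMap_of_le hf2, hMap_of_le hg2, hfx, hgx]
      refine ENNReal.ofReal_le_ofReal (abs_le.2 ⟨?_, ?_⟩) <;> linarith
  · rw [hgG x ⟨hx, by linarith⟩, hGlow hxa]
  · rw [← Subtype.coe_lt_coe, ← realExt_coe, hgG _ x.2]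
    have hx0 : (0 : ℝ) < x := hx.1
    rcases le_total (x : ℝ) a with hxa | hax
    · rw [hGlow hxa]
      exact mul_lt_of_lt_one_left hx0 hκ1
    rcases lt_or_ge (x : ℝ) b with hxb | hbx
    · have hφb' : φ b < b := by
        rw [hφ, realExt_of_mem _ ⟨hb0.le, by linarith⟩]
        exact hlt ⟨b, hb0.le, by linarith⟩ ⟨hb0, show b < 1 by linarith⟩
      refine lt_of_mul_lt_mul_left ?_ (sub_pos.2 hab).le
      rw [hseg hax hxb.le]
      have h1 := mul_lt_mul_of_pos_right hκ1 (mul_pos ha0 (sub_pos.2 hxb))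
      have h2 := mul_le_mul_of_nonneg_right hφb'.le (sub_nonneg.2 hax)
      linarith
    · rw [hGhigh hbx, hφ, realExt_coe]
      exact hlt x hx
  · rw [← Subtype.coe_lt_coe, ← realExt_coe, hgG _ x.2]
    have hx0 : (0 : ℝ) < x := hx.1
    rcases le_total (x : ℝ) a with hxa | hax
    · rw [hGlow hxa]
      exact lt_mul_of_one_lt_left hx0 hκ1
    rcases lt_or_ge (x : ℝ) b with hxb | hbx
    · have hφb' : b < φ b := by
        rw [hφ, realExt_of_mem _ ⟨hb0.le, by linarith⟩]
        exact hlt ⟨b, hb0.le, by linarith⟩ ⟨hb0, show b < 1 by linarith⟩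
      refine lt_of_mul_lt_mul_left ?_ (sub_pos.2 hab).le
      rw [hseg hax hxb.le]
      have h1 := mul_lt_mul_of_pos_right hκ1 (mul_pos ha0 (sub_pos.2 hxb))
      have h2 := mul_le_mul_of_nonneg_right hφb'.le (sub_nonneg.2 hax)
      linarith
    · rw [hGhigh hbx, hφ, realExt_coe]
      exact hlt x hx

end CI

/-! ### Density -/

theorem CI.endDeriv_zero_le_one {f : CI} (h : ∀ x ∈ Ioo (0 : I) 1, f.toMap x < x) :
    endDeriv f.toMap 0 ≤ 1 := by
  refine le_of_tendsto f.tendsto_div_nhdsGT_zero ?_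
  filter_upwards [Ioo_mem_nhdsGT zero_lt_one] with x hx
  rw [div_le_one hx.1, realExt_of_mem _ (Ioo_subset_Icc_self hx)]
  exact (h ⟨x, Ioo_subset_Icc_self hx⟩ hx).le

theorem CI.one_le_endDeriv_zero {f : CI} (h : ∀ x ∈ Ioo (0 : I) 1, x < f.toMap x) :
    1 ≤ endDeriv f.toMap 0 := by
  refine ge_of_tendsto f.tendsto_div_nhdsGT_zero ?_
  filter_upwards [Ioo_mem_nhdsGT zero_lt_one] with x hx
  rw [one_le_div hx.1, realExt_of_mem _ (Ioo_subset_Icc_self hx)]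
  exact (h ⟨x, Ioo_subset_Icc_self hx⟩ hx).le

/-- Translation lengths `α`, `β` near `A`, `B` may be chosen incommensurable, keeping the drift
`-(p * α) + (1 - p) * β` positive. -/
theorem exists_irrational_drift {p A B δ : ℝ} (hp : p ∈ Ioo (0 : ℝ) 1) (hA : 0 ≤ A) (hB : 0 ≤ B)
    (h : 0 < -(p * A) + (1 - p) * B) (hδ : 0 < δ) :
    ∃ α β : ℝ, 0 < α ∧ 0 < β ∧ |A - α| < δ ∧ |B - β| < δ ∧ Irrational (β / α) ∧
      0 < -(p * α) + (1 - p) * β := by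
  set η := min (δ / 2) (-(p * A) + (1 - p) * B)
  have hη : 0 < η := lt_min (half_pos hδ) h
  have hα : 0 < A + η := by linarith
  obtain ⟨r, hr, hr1, hr2⟩ := exists_irrational_btwn
    (div_lt_div_of_pos_right (lt_add_of_pos_right B hδ) hα)
  rw [div_lt_iff₀ hα] at hr1
  rw [lt_div_iff₀ hα] at hr2
  refine ⟨A + η, r * (A + η), hα, by linarith, ?_, ?_, ?_, ?_⟩
  · rw [sub_add_cancel_left, abs_neg, abs_of_pos hη]
    exact (min_le_left _ _).trans_lt (half_lt_self hδ)
  · rw [abs_lt]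
    constructor <;> linarith
  · rwa [mul_div_cancel_right₀ _ hα.ne']
  · have h1 := mul_lt_mul_of_pos_left hr1 (sub_pos.2 hp.2)
    have h2 := mul_lt_mul_of_pos_right hp.2 hη
    have h3 := min_le_right (δ / 2) (-(p * A) + (1 - p) * B)
    linarith

end

theorem mainTheorem4 :
    Dense {f : RDSI | ∃ μ : ProbabilityMeasure (Ioo (0 : ℝ) 1),
      f.IsStationary μ ∧ (∀ ν : ProbabilityMeasure (Ioo (0 : ℝ) 1), f.IsStationary ν → ν = μ) ∧
        HasFullSupport μ} := by
  intro f
  rw [EMetric.mem_closure_iff]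
  intro ε hε
  obtain ⟨δ, hδ, hδε⟩ := ENNReal.lt_iff_exists_nnreal_btwn.1 hε
  have hδ0 : (0 : ℝ) < δ / 2 := half_pos (by exact_mod_cast hδ)
  have hA := CI.endDeriv_zero_le_one f.below
  have hB := CI.one_le_endDeriv_zero f.above
  obtain ⟨α, β, hα, hβ, hAα, hBβ, hirr, hdrift⟩ := exists_irrational_drift f.p_mem
    (neg_nonneg.2 (Real.log_nonpos f.f₀.deriv_zero_pos.le hA)) (Real.log_nonneg hB)
    (by linarith [f.lyapunov_zero_pos]) hδ0
  have hκ₀ : Real.exp (-α) < 1 := Real.exp_lt_one_iff.2 (by linarith)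
  have hκ₁ : 1 < Real.exp β := Real.one_lt_exp_iff.2 hβ
  -- The probability `p` and the derivatives at `1` are kept; near `0` the two maps become linear with
  -- slopes `exp (-α)` and `exp β`.
  obtain ⟨g₀, hg₀, hd₀, hg₀0, hg₀1, ⟨a₀, ha₀, hlin₀⟩, hbelow, -⟩ :=
    CI.exists_linear_near_zero f.homeo₀ (Real.exp_pos (-α)) (δ := δ / 2)
      (by rw [Real.log_exp, ← abs_neg]; convert hAα using 2; ring)
  obtain ⟨g₁, hg₁, hd₁, hg₁0, hg₁1, ⟨a₁, ha₁, hlin₁⟩, -, habove⟩ :=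
    CI.exists_linear_near_zero f.homeo₁ (Real.exp_pos β) (δ := δ / 2)
      (by rwa [Real.log_exp])
  let g : RDSI :=
    { f₀ := g₀
      f₁ := g₁
      p := f.p
      homeo₀ := hg₀
      homeo₁ := hg₁
      below := hbelow hκ₀ f.below
      above := habove hκ₁ f.above
      p_mem := f.p_mem
      lyapunov_zero_pos := by
        rw [hg₀0, hg₁0, Real.log_exp, Real.log_exp]
        linarith
      lyapunov_one_pos := by
        rw [hg₀1, hg₁1]
        exact f.lyapunov_one_pos }
  obtain ⟨μ, hμ, huniq⟩ := g.existsUnique_isStationary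
  refine ⟨g, ⟨μ, hμ, huniq, ?_⟩, lt_of_le_of_lt ?_ hδε⟩
  · refine g.hasFullSupport_of_isStationary (lt_min ha₀ ha₁) (Real.exp_pos (-α)) hκ₀ hκ₁ ?_
      (fun x hx => hlin₀ x (hx.trans (min_le_left _ _)))
      (fun x hx => hlin₁ x (hx.trans (min_le_right _ _))) hμ
    rwa [Real.log_exp, Real.log_exp, neg_neg]
  · rw [mul_div_cancel₀ _ two_ne_zero, ENNReal.ofReal_coe_nnreal] at hd₀ hd₁
    change edist f.toTriple g.toTriple ≤ δ
    rw [Prod.edist_eq, Prod.edist_eq]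
    refine max_le hd₀ (max_le hd₁ ?_)
    simp [RDSI.toTriple, g]
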